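/- Let $\mathbb{R}^{3\times 3}_{\rm sym}$ be the space of real symmetric $3\times 3$ matrices with the Frobenius inner product $A:B=\sum_{i,j}A_{ij}B_{ij}$ and norm $|A|^2=A:A$, let $r_2>0$, and let $B_{r_2}=\{A\in\mathbb{R}^{3\times 3}_{\rm sym}:\ |A|\le r_2\}$. Let $F\in C^2(B_{r_2})$ be real-valued with $F(0)=0$, let $\partial F$ be its gradient with respect to the Frobenius inner product, and let $\mathcal{L}[A]=A-\frac13\operatorname{tr}[A]\,I$. Suppose that $Q:\mathbb{R}^3\to\mathbb{R}^{3\times 3}_{\rm sym}$ is traceless, $|Q|\le r_2$ almost everywhere, $Q$ has a weak gradient $\nabla Q$ with $|\nabla Q|^2=\sum_{i=1}^3|\partial_iQ|^2\in L^1(\mathbb{R}^3)$, $F(Q)\in L^1(\mathbb{R}^3)$, and $$-\Delta Q+\mathcal{L}[\partial F(Q)]=0\quad\text{in }\mathbb{R}^3$$ in the sense of distributions. Then $$\int_{\mathbb{R}^3}\Big(\tfrac12|\nabla Q|^2+3F(Q)\Big)\,dx=0.$$ In particular, if $F\ge 0$ on $B_{r_2}$, then $Q$ is (almost everywhere) equal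 to a constant traceless matrix $q\in B_{r_2}$ with $F(q)=0$; and if $F(A)>0$ for every $A\in B_{r_2}\setminus\{0\}$, then $Q\equiv 0$ (almost everywhere). -/

import Mathlib

open MeasureTheory
open scoped ContDiff

noncomputable section

/-- The physical space `ℝ³` with its Euclidean norm. -/
abbrev Space : Type := EuclideanSpace ℝ (Fin 3)

/-- Real symmetric `3 × 3` matrices, as a linear subspace of the space of all families
`(A (i, j))` of nine real numbers. The inner product and the norm it inherits are the Frobenius
ones, `A : B = ∑ i j, A (i, j) * B (i, j)` and `|A|² = A : A`. -/
def symSubmodule : Submodule ℝ (EuclideanSpace ℝ (Fin 3 × Fin 3)) where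
  carrier := {A | ∀ i j, A (i, j) = A (j, i)}
  add_mem' := by
    intro A B hA hB i j
    simp [hA i j, hB i j]
  zero_mem' := by
    intro i j
    simp
  smul_mem' := by
    intro c A hA i j
    simp [hA i j]

/-- The Euclidean space of real symmetric `3 × 3` matrices with the Frobenius inner product. -/
abbrev SymMat : Type := symSubmodule

namespace SymMat

/-- The trace `∑ i, A (i, i)`. -/
def tr (A : SymMat) : ℝ := ∑ i : Fin 3, A.1 (i, i)

/-- The identity matrix. -/
def idMat : SymMat :=
  ⟨WithLp.toLp 2 fun p => if p.1 = p.2 then 1 else 0, by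
    intro i j
    simp [eq_comm]⟩

/-- The projection `𝓛[A] = A - (1/3) tr[A] I` onto the traceless symmetric matrices. -/
def tracelessPart (A : SymMat) : SymMat := A - ((1 / 3 : ℝ) * tr A) • idMat

end SymMat

/-- Smooth compactly supported real test functions on `ℝ³`. -/
def IsTestFunction (φ : Space → ℝ) : Prop := ContDiff ℝ ∞ φ ∧ HasCompactSupport φ

/-- `G = (G 0, G 1, G 2)` is the weak (distributional) gradient of the matrix field `Q`:
both are locally integrable, and `∫ (∂ᵢφ) Q = - ∫ φ Gᵢ` for all test functions `φ`. -/
def HasWeakGradient (Q : Space → SymMat) (G : Fin 3 → Space → SymMat) : Prop :=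
  LocallyIntegrable Q ∧ ∀ i : Fin 3, LocallyIntegrable (G i) ∧
    ∀ φ : Space → ℝ, IsTestFunction φ →
      ∫ x, (fderiv ℝ φ x (EuclideanSpace.single i 1)) • Q x = - ∫ x, φ x • G i x

/-- The squared Frobenius norm `|∇Q|² = ∑ i, |∂ᵢQ|²` of a gradient with components `G i`. -/
def gradNormSq (G : Fin 3 → Space → SymMat) (x : Space) : ℝ := ∑ i : Fin 3, ‖G i x‖ ^ 2

/-- `-ΔQ + g = 0` in the sense of distributions on `ℝ³`: both fields are locally integrable and
`∫ (-Δφ) Q + ∫ φ g = 0` for all test functions `φ`. -/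
def SolvesPoissonWeakly (Q g : Space → SymMat) : Prop :=
  LocallyIntegrable Q ∧ LocallyIntegrable g ∧
    ∀ φ : Space → ℝ, IsTestFunction φ →
      (∫ x, (- Laplacian.laplacian φ x) • Q x) + ∫ x, φ x • g x = 0

/-- `∂F(q)`, the gradient with respect to the Frobenius inner product of a function defined on
the closed ball of radius `r` in the symmetric matrices; on the boundary sphere this is the
one-sided gradient relative to the ball. -/
def potentialGrad (F : SymMat → ℝ) (r : ℝ) (q : SymMat) : SymMat :=
  gradientWithin F (Metric.closedBall 0 r) q

/-- `Q` is a weak solution of `-ΔQ + 𝓛[∂F(Q)] = 0` on `ℝ³`, where `F` is given on the closed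
ball of radius `r`. -/
def IsStationarySolution (F : SymMat → ℝ) (r : ℝ) (Q : Space → SymMat) : Prop :=
  SolvesPoissonWeakly Q fun x => SymMat.tracelessPart (potentialGrad F r (Q x))

end

open Filter Topology Metric
open scoped Convolution RealInnerProductSpace

/-! The equation is the Euler-Lagrange equation of the energy with density `½|∇Q|² + F(Q)`, so the
energy is stationary under deformations of the domain: for every test vector field `X`, `∫ (∂ᵢXⱼ ∂ᵢQ
: ∂ⱼQ - div X (½|∇Q|² + F(Q))) = 0`. This is `integral_inner_variation`. Taking for `X` the field
`x`, cut off at scale `R`, gives `∂ᵢXⱼ → δᵢⱼ` with bounds uniform in `R`. Finite energy then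
suffices to pass to the limit, and `|∇Q|² - (3/2)|∇Q|² - 3F(Q)` has integral zero
(`pohozaev_identity`).

No second derivatives of `Q` are used. The mollified map `Qₙ` is smooth, takes values in the convex
ball where `F` is defined, and satisfies `ΔQₙ = gₙ`, with `gₙ` the mollified `𝓛[∂F(Q)]`. Two exact
identities hold for it: `integral_stress_energy`, containing `Xⱼ gₙ : ∂ⱼQₙ`, and
`integral_potential`, containing `Xⱼ DF(Qₙ)[∂ⱼQₙ]`. These terms agree only in the limit, where `∂ⱼQ`
is traceless and does not see `𝓛`. The limit is taken by dominated convergence with bounds built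
from the mollified `|∇Q|²`, whose integral does not depend on `n`.

If `F ≥ 0`, the Pohozaev integrand is nonnegative and hence zero, so `∇Q = 0` and `Q` is constant.
-/

/-! ### Dominated convergence with a varying bound -/

/-- `f n` converges to `g` almost everywhere and `|f n| ≤ C b n` for some constant `C`. -/
structure DominatedLimit {α : Type*} [MeasurableSpace α] (μ : Measure α) (b : ℕ → α → ℝ)
    (f : ℕ → α → ℝ) (g : α → ℝ) : Prop where
  aestronglyMeasurable : ∀ n, AEStronglyMeasurable (f n) μ
  bound : ∃ C : ℝ, ∀ n, ∀ᵐ x ∂μ, |f n x| ≤ C * b n x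
  tendsto : ∀ᵐ x ∂μ, Tendsto (fun n => f n x) atTop (𝓝 (g x))

namespace DominatedLimit

variable {α : Type*} [MeasurableSpace α] {μ : Measure α} {b : ℕ → α → ℝ}
  {f f' : ℕ → α → ℝ} {g g' : α → ℝ}

theorem add (h : DominatedLimit μ b f g) (h' : DominatedLimit μ b f' g') :
    DominatedLimit μ b (fun n x => f n x + f' n x) (fun x => g x + g' x) := by
  refine ⟨fun n => (h.1 n).add (h'.1 n), ?_, ?_⟩
  · obtain ⟨C, hC⟩ := h.2
    obtain ⟨C', hC'⟩ := h'.2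
    refine ⟨C + C', fun n => ?_⟩
    filter_upwards [hC n, hC' n] with x hx hx'
    calc _ ≤ |f n x| + |f' n x| := abs_add_le _ _
      _ ≤ _ := by linarith
  · filter_upwards [h.3, h'.3] with x hx hx' using hx.add hx'

theorem const_mul (h : DominatedLimit μ b f g) (c : ℝ) :
    DominatedLimit μ b (fun n x => c * f n x) (fun x => c * g x) := by
  refine ⟨fun n => (h.1 n).const_mul c, ?_, ?_⟩
  · obtain ⟨C, hC⟩ := h.2
    refine ⟨|c| * C, fun n => ?_⟩
    filter_upwards [hC n] with x hx
    rw [abs_mul, mul_assoc]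
    gcongr
  · filter_upwards [h.3] with x hx using hx.const_mul c

theorem sub (h : DominatedLimit μ b f g) (h' : DominatedLimit μ b f' g') :
    DominatedLimit μ b (fun n x => f n x - f' n x) (fun x => g x - g' x) := by
  simpa [sub_eq_add_neg] using h.add (h'.const_mul (-1))

theorem sum {ι : Type*} (s : Finset ι) {f : ι → ℕ → α → ℝ} {g : ι → α → ℝ}
    (h : ∀ i ∈ s, DominatedLimit μ b (f i) (g i)) :
    DominatedLimit μ b (fun n x => ∑ i ∈ s, f i n x) (fun x => ∑ i ∈ s, g i x) := by
  classical
  induction s using Finset.induction_on with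
  | empty =>
    exact ⟨fun n => by simpa using aestronglyMeasurable_const,
      ⟨0, fun n => by simp⟩, by simp⟩
  | insert i s hi ih =>
    simp only [Finset.sum_insert hi]
    exact (h i (by simp)).add (ih fun j hj => h j (by simp [hj]))

theorem integrable (h : DominatedLimit μ b f g) (hb : ∀ n, Integrable (b n) μ) (n : ℕ) :
    Integrable (f n) μ := by
  obtain ⟨C, hC⟩ := h.bound
  exact ((hb n).const_mul C).mono' (h.1 n) (hC n)

/-- Clamp `f n` to `[-B, B]`. The clamped functions obey ordinary dominated convergence, and the
error is at most `b n - min (b n) B`, whose integral tends to `∫ B - ∫ B = 0`. -/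
theorem tendsto_integral_of_bound_one {B : α → ℝ}
    (hf : ∀ n, AEStronglyMeasurable (f n) μ) (hfb : ∀ n, ∀ᵐ x ∂μ, |f n x| ≤ b n x)
    (hfg : ∀ᵐ x ∂μ, Tendsto (fun n => f n x) atTop (𝓝 (g x)))
    (hb : ∀ n, Integrable (b n) μ) (hB : Integrable B μ)
    (hbB : ∀ᵐ x ∂μ, Tendsto (fun n => b n x) atTop (𝓝 (B x)))
    (hint : Tendsto (fun n => ∫ x, b n x ∂μ) atTop (𝓝 (∫ x, B x ∂μ))) :
    Tendsto (fun n => ∫ x, f n x ∂μ) atTop (𝓝 (∫ x, g x ∂μ)) := by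
  have hgB : ∀ᵐ x ∂μ, |g x| ≤ B x := by
    filter_upwards [hfg, hbB, ae_all_iff.2 hfb] with x h1 h2 h3
    exact le_of_tendsto_of_tendsto' h1.abs h2 h3
  have hcmeas : ∀ n, AEStronglyMeasurable (fun x => min (b n x) (B x)) μ := fun n =>
    (hb n).1.inf hB.1
  have hcbd : ∀ n, ∀ᵐ x ∂μ, ‖min (b n x) (B x)‖ ≤ B x := fun n => by
    filter_upwards [hfb n, hgB] with x h1 h2
    have hb0 := (abs_nonneg _).trans h1
    have hB0 := (abs_nonneg _).trans h2
    rw [Real.norm_of_nonneg (le_min hb0 hB0)]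
    exact min_le_right _ _
  have hcint : ∀ n, Integrable (fun x => min (b n x) (B x)) μ := fun n =>
    hB.mono' (hcmeas n) (hcbd n)
  have hc : Tendsto (fun n => ∫ x, min (b n x) (B x) ∂μ) atTop (𝓝 (∫ x, B x ∂μ)) := by
    refine tendsto_integral_of_dominated_convergence B hcmeas hB hcbd ?_
    filter_upwards [hbB] with x hx
    simpa using hx.min (tendsto_const_nhds (x := B x))
  have hdmeas : ∀ n, AEStronglyMeasurable (fun x => max (-B x) (min (f n x) (B x))) μ := fun n =>
    hB.1.neg.sup ((hf n).inf hB.1)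
  have hdbd : ∀ n, ∀ᵐ x ∂μ, ‖max (-B x) (min (f n x) (B x))‖ ≤ B x := fun n => by
    filter_upwards [hgB] with x h2
    have hB0 := (abs_nonneg _).trans h2
    rw [Real.norm_eq_abs, abs_le]
    exact ⟨le_max_left _ _, max_le (by linarith) (min_le_right _ _)⟩
  have hdint : ∀ n, Integrable (fun x => max (-B x) (min (f n x) (B x))) μ := fun n =>
    hB.mono' (hdmeas n) (hdbd n)
  have hd : Tendsto (fun n => ∫ x, max (-B x) (min (f n x) (B x)) ∂μ) atTop
      (𝓝 (∫ x, g x ∂μ)) := by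
    refine tendsto_integral_of_dominated_convergence B hdmeas hB hdbd ?_
    filter_upwards [hfg, hgB] with x hx h2
    have := (tendsto_const_nhds (x := -B x)).max (hx.min (tendsto_const_nhds (x := B x)))
    rwa [min_eq_left (abs_le.1 h2).2, max_eq_right (abs_le.1 h2).1] at this
  have hfint : ∀ n, Integrable (f n) μ := fun n => (hb n).mono' (hf n) (hfb n)
  have hdiff : Tendsto (fun n => ∫ x, (f n x - max (-B x) (min (f n x) (B x))) ∂μ) atTop
      (𝓝 0) := by
    have hz : Tendsto (fun n => ∫ x, (b n x - min (b n x) (B x)) ∂μ) atTop (𝓝 0) := by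
      have := hint.sub hc
      rw [sub_self] at this
      refine this.congr fun n => ?_
      rw [integral_sub (hb n) (hcint n)]
    refine squeeze_zero_norm (fun n => ?_) hz
    refine norm_integral_le_of_norm_le ((hb n).sub (hcint n)) ?_
    filter_upwards [hfb n, hgB] with x h1 h2
    have hB0 := (abs_nonneg _).trans h2
    have h3 := abs_le.1 h1
    rw [Real.norm_eq_abs, abs_le]
    -- Clamping moves `f n x` only when `|f n x| > B x`, and then by `|f n x| - B x ≤ b n x - B x`.
    rcases max_cases (-B x) (min (f n x) (B x)) with ⟨h, h'⟩ | ⟨h, h'⟩ <;>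
    rcases min_cases (f n x) (B x) with ⟨k, k'⟩ | ⟨k, k'⟩ <;>
    rcases min_cases (b n x) (B x) with ⟨l, l'⟩ | ⟨l, l'⟩ <;>
    rw [h, l] <;> (try rw [k]) <;> (try rw [k] at h') <;> constructor <;> linarith
  have := hdiff.add hd
  rw [zero_add] at this
  refine this.congr fun n => ?_
  rw [integral_sub (hfint n) (hdint n)]
  ring

/-- Dominated convergence with bounds `C b n`, where `b n` and its integral converge. -/
theorem tendsto_integral {B : α → ℝ} (h : DominatedLimit μ b f g)
    (hb : ∀ n, Integrable (b n) μ) (hB : Integrable B μ)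
    (hbB : ∀ᵐ x ∂μ, Tendsto (fun n => b n x) atTop (𝓝 (B x)))
    (hint : Tendsto (fun n => ∫ x, b n x ∂μ) atTop (𝓝 (∫ x, B x ∂μ))) :
    Tendsto (fun n => ∫ x, f n x ∂μ) atTop (𝓝 (∫ x, g x ∂μ)) := by
  obtain ⟨C, hC⟩ := h.bound
  refine tendsto_integral_of_bound_one (b := fun n x => C * b n x) (B := fun x => C * B x)
    h.1 hC h.3 (fun n => (hb n).const_mul C) (hB.const_mul C) ?_ ?_
  · filter_upwards [hbB] with x hx using hx.const_mul C
  · simpa only [integral_const_mul] using hint.const_mul C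

end DominatedLimit

/-! ### Convolution with smooth kernels -/

section Convolution

variable {V : Type*} [NormedAddCommGroup V] [NormedSpace ℝ V] [FiniteDimensional ℝ V]
  [MeasurableSpace V] [BorelSpace V] {μ : Measure V} [μ.IsAddHaarMeasure]

/-- Integration by parts against the constant `1`, admissible because only the products have to be
integrable. -/
theorem integral_fderiv_apply_eq_zero {f : V → ℝ} (hf : Differentiable ℝ f) {v : V}
    (hf' : Continuous fun x => fderiv ℝ f x v) (hc : HasCompactSupport f) :
    ∫ x, fderiv ℝ f x v ∂μ = 0 := by
  have h1 : HasCompactSupport fun x => fderiv ℝ f x v := hc.fderiv_apply (𝕜 := ℝ) v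
  have := integral_mul_fderiv_eq_neg_fderiv_mul_of_integrable (μ := μ) (f := fun _ : V => (1 : ℝ))
    (g := f) (v := v) (by simp) (by simpa using hf'.integrable_of_hasCompactSupport h1)
    (by simpa using hf.continuous.integrable_of_hasCompactSupport hc)
    (fun x _ => differentiableAt_const _) (fun x _ => hf x)
  simpa using this

variable {E : Type*} [NormedAddCommGroup E] [NormedSpace ℝ E]

/-- Convolution of a scalar kernel with a vector-valued function. -/
noncomputable abbrev smoothConv (μ : Measure V) (ρ : V → ℝ) (f : V → E) : V → E :=
  ρ ⋆[ContinuousLinearMap.lsmul ℝ ℝ, μ] f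

variable {ρ : V → ℝ} {f : V → E}

theorem smoothConv_integrable (hρ : Continuous ρ) (hc : HasCompactSupport ρ)
    (hf : LocallyIntegrable f μ) (x : V) : Integrable (fun y => ρ (x - y) • f y) μ := by
  have := (hc.convolutionExists_left (ContinuousLinearMap.lsmul ℝ ℝ) hρ hf x).integrable_swap
  simpa using this

theorem smoothConv_apply (x : V) : smoothConv μ ρ f x = ∫ y, ρ (x - y) • f y ∂μ :=
  convolution_lsmul_swap

theorem fderiv_smoothConv_apply [CompleteSpace E] (hρ : ContDiff ℝ ∞ ρ) (hc : HasCompactSupport ρ)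
    (hf : LocallyIntegrable f μ) (x v : V) :
    fderiv ℝ (smoothConv μ ρ f) x v = smoothConv μ (fun t => fderiv ℝ ρ t v) f x := by
  have hρ1 : ContDiff ℝ 1 ρ := hρ.of_le (by simp)
  rw [(hc.hasFDerivAt_convolution_left (ContinuousLinearMap.lsmul ℝ ℝ) hρ1 hf x).fderiv]
  have hint := (hc.fderiv (𝕜 := ℝ)).convolutionExists_left
    ((ContinuousLinearMap.lsmul ℝ ℝ : ℝ →L[ℝ] E →L[ℝ] E).precompL V)
    (hρ1.continuous_fderiv one_ne_zero) hf x
  simp only [smoothConv, convolution]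
  rw [ContinuousLinearMap.integral_apply hint]
  simp

theorem contDiff_smoothConv [CompleteSpace E] (hρ : ContDiff ℝ ∞ ρ) (hc : HasCompactSupport ρ)
    (hf : LocallyIntegrable f μ) : ContDiff ℝ ∞ (smoothConv μ ρ f) :=
  hc.contDiff_convolution_left _ hρ hf

theorem integral_kernel_sub_left (ρ : V → ℝ) (x : V) : ∫ y, ρ (x - y) ∂μ = ∫ y, ρ y ∂μ :=
  integral_sub_left_eq_self ρ μ x

/-- Averaging against a probability density does not leave a ball. This keeps the mollified `Q` in
the domain of `F`, at every point and not only almost everywhere. -/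
theorem norm_smoothConv_le (hρ : Continuous ρ) (hc : HasCompactSupport ρ) (h0 : ∀ x, 0 ≤ ρ x)
    (h1 : ∫ x, ρ x ∂μ = 1) {C : ℝ} (hf : ∀ᵐ x ∂μ, ‖f x‖ ≤ C) (x : V) :
    ‖smoothConv μ ρ f x‖ ≤ C := by
  rw [smoothConv_apply]
  have hρx : Integrable (fun y => ρ (x - y)) μ :=
    (hρ.integrable_of_hasCompactSupport hc).comp_sub_left x
  calc ‖∫ y, ρ (x - y) • f y ∂μ‖ ≤ ∫ y, ρ (x - y) * C ∂μ := by
        refine norm_integral_le_of_norm_le (hρx.mul_const C) ?_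
        filter_upwards [hf] with y hy
        rw [norm_smul, Real.norm_of_nonneg (h0 _)]
        exact mul_le_mul_of_nonneg_left hy (h0 _)
    _ = C := by rw [integral_mul_const, integral_kernel_sub_left, h1, one_mul]

end Convolution

section Jensen

variable {V : Type*} [NormedAddCommGroup V] [NormedSpace ℝ V] [FiniteDimensional ℝ V]
  [MeasurableSpace V] [BorelSpace V] {μ : Measure V} [μ.IsAddHaarMeasure]
  {E : Type*} [NormedAddCommGroup E] [InnerProductSpace ℝ E] [CompleteSpace E]

/-- Jensen's inequality for the squared norm of a mollified function. -/
theorem norm_sq_smoothConv_le {ρ : V → ℝ} {f : V → E} (hρ : Continuous ρ)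
    (hc : HasCompactSupport ρ) (h0 : ∀ x, 0 ≤ ρ x) (h1 : ∫ x, ρ x ∂μ = 1)
    (hf : LocallyIntegrable f μ) (hf2 : LocallyIntegrable (fun x => ‖f x‖ ^ 2) μ) (x : V) :
    ‖smoothConv μ ρ f x‖ ^ 2 ≤ smoothConv μ ρ (fun y => ‖f y‖ ^ 2) x := by
  set c := smoothConv μ ρ f x with hcdef
  have hi := smoothConv_integrable hρ hc hf x
  have hi2 := smoothConv_integrable hρ hc hf2 x
  have hρx : Integrable (fun y => ρ (x - y)) μ :=
    (hρ.integrable_of_hasCompactSupport hc).comp_sub_left x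
  have hinner : Integrable (fun y => ⟪c, ρ (x - y) • f y⟫) μ := hi.const_inner c
  have hcc : ∫ y, ⟪c, ρ (x - y) • f y⟫ ∂μ = ‖c‖ ^ 2 := by
    rw [integral_inner hi, ← smoothConv_apply, ← hcdef, real_inner_self_eq_norm_sq]
  -- The integrand is `ρ (x - y) * ‖c - f y‖ ^ 2` expanded: the variance about the mean `c` is
  -- nonnegative.
  have hnn : 0 ≤ ∫ y, (ρ (x - y) * ‖c‖ ^ 2 - 2 * ⟪c, ρ (x - y) • f y⟫
      + ρ (x - y) • ‖f y‖ ^ 2) ∂μ := by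
    refine integral_nonneg fun y => ?_
    have : 0 ≤ ρ (x - y) * ‖c - f y‖ ^ 2 := mul_nonneg (h0 _) (sq_nonneg _)
    rw [norm_sub_sq_real] at this
    simp only [Pi.zero_apply, inner_smul_right, smul_eq_mul]
    linarith
  have e1 : Integrable (fun y => ρ (x - y) * ‖c‖ ^ 2 - 2 * ⟪c, ρ (x - y) • f y⟫) μ :=
    (hρx.mul_const _).sub (hinner.const_mul 2)
  rw [integral_add e1 hi2, integral_sub (hρx.mul_const _) (hinner.const_mul 2),
    integral_mul_const, integral_const_mul, hcc, integral_kernel_sub_left, h1,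
    ← smoothConv_apply] at hnn
  linarith

end Jensen

/-! ### Weak derivatives and mollification -/

/-- The standard unit vectors of `ℝ³`. -/
noncomputable abbrev unitVec (i : Fin 3) : Space := EuclideanSpace.single i 1

section WeakDerivative

variable {E : Type*} [NormedAddCommGroup E] [NormedSpace ℝ E]

/-- `w` is the weak derivative of `u` in the direction `v`. -/
def HasWeakDeriv (v : Space) (u w : Space → E) : Prop :=
  ∀ φ : Space → ℝ, IsTestFunction φ → ∫ x, fderiv ℝ φ x v • u x = - ∫ x, φ x • w x

theorem IsTestFunction.fderiv_apply {φ : Space → ℝ} (h : IsTestFunction φ) (v : Space) :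
    IsTestFunction fun x => fderiv ℝ φ x v :=
  ⟨(h.1.fderiv_right (m := ∞) (by simp)).clm_apply contDiff_const, h.2.fderiv_apply (𝕜 := ℝ) v⟩

theorem IsTestFunction.comp_sub_left {ρ : Space → ℝ} (h : IsTestFunction ρ) (x : Space) :
    IsTestFunction fun y => ρ (x - y) :=
  ⟨h.1.comp (contDiff_const.sub contDiff_id),
    h.2.comp_homeomorph (Homeomorph.subLeft x)⟩

theorem fderiv_comp_sub_left_apply {ρ : Space → ℝ} (h : Differentiable ℝ ρ) (x y v : Space) :
    fderiv ℝ (fun z => ρ (x - z)) y v = - fderiv ℝ ρ (x - y) v := by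
  have h1 : HasFDerivAt (fun z : Space => x - z) (-ContinuousLinearMap.id ℝ Space) y := by
    simpa using (hasFDerivAt_id y).const_sub x
  have := ((h (x - y)).hasFDerivAt.comp y h1).fderiv
  rw [show (fun z => ρ (x - z)) = ρ ∘ fun z => x - z from rfl, this]
  simp

theorem laplacian_eq_sum_fderiv_fderiv {φ : Space → ℝ} (h : ContDiff ℝ ∞ φ) (x : Space) :
    Laplacian.laplacian φ x =
      ∑ i, fderiv ℝ (fun y => fderiv ℝ φ y (unitVec i)) x (unitVec i) := by
  rw [InnerProductSpace.laplacian_eq_iteratedFDeriv_orthonormalBasis φ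
    (EuclideanSpace.basisFun (Fin 3) ℝ)]
  refine Finset.sum_congr rfl fun i _ => ?_
  have hd : DifferentiableAt ℝ (fderiv ℝ φ) x :=
    ((h.fderiv_right (m := ∞) (by simp)).differentiable (by simp)) x
  rw [iteratedFDeriv_two_apply, fderiv_clm_apply hd (differentiableAt_const _)]
  simp

theorem IsTestFunction.integrable_smul {φ : Space → ℝ} (h : IsTestFunction φ) {u : Space → E}
    (hu : LocallyIntegrable u) : Integrable fun x => φ x • u x :=
  hu.integrable_smul_left_of_hasCompactSupport h.1.continuous h.2

variable [CompleteSpace E]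

/-- Test with `y ↦ ρ (x - y)`: the sign from the reflection cancels the one in the definition of the
weak derivative. -/
theorem HasWeakDeriv.fderiv_smoothConv {v : Space} {u w : Space → E} (h : HasWeakDeriv v u w)
    (hu : LocallyIntegrable u) {ρ : Space → ℝ} (hρ : IsTestFunction ρ) (x : Space) :
    fderiv ℝ (smoothConv volume ρ u) x v = smoothConv volume ρ w x := by
  have hd : Differentiable ℝ ρ := hρ.1.differentiable (by simp)
  rw [fderiv_smoothConv_apply hρ.1 hρ.2 hu, smoothConv_apply, smoothConv_apply]
  have := h _ (hρ.comp_sub_left x)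
  simp only [fderiv_comp_sub_left_apply hd, neg_smul, integral_neg, neg_inj] at this
  exact this

/-- With the reflected kernel as test function, one of the two derivatives in the Laplacian is moved
onto `u` and becomes `w i`; the other stays on the kernel. -/
theorem sum_fderiv_smoothConv_of_weak_poisson {u g : Space → E} {w : Fin 3 → Space → E}
    (hu : LocallyIntegrable u) (hw : ∀ i, LocallyIntegrable (w i))
    (h : ∀ i, HasWeakDeriv (unitVec i) u (w i))
    (hg : ∀ φ : Space → ℝ, IsTestFunction φ →
      (∫ x, (- Laplacian.laplacian φ x) • u x) + ∫ x, φ x • g x = 0)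
    {ρ : Space → ℝ} (hρ : IsTestFunction ρ) (x : Space) :
    ∑ i, fderiv ℝ (smoothConv volume ρ (w i)) x (unitVec i) = smoothConv volume ρ g x := by
  have hd : Differentiable ℝ ρ := hρ.1.differentiable (by simp)
  have hφ := hρ.comp_sub_left x
  have h1 := hg _ hφ
  simp only [neg_smul, integral_neg, laplacian_eq_sum_fderiv_fderiv hφ.1, Finset.sum_smul] at h1
  rw [integral_finsetSum _ fun i _ =>
    ((hφ.fderiv_apply _).fderiv_apply _).integrable_smul hu] at h1
  simp only [h _ _ (hφ.fderiv_apply _)] at h1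
  simp only [fderiv_comp_sub_left_apply hd, neg_smul, integral_neg, neg_neg] at h1
  simp only [fderiv_smoothConv_apply hρ.1 hρ.2 (hw _), smoothConv_apply]
  exact (neg_add_eq_zero.1 h1)

end WeakDerivative

/-- A sequence of bump functions concentrating at the origin. -/
noncomputable def bumpSeq (n : ℕ) : ContDiffBump (0 : Space) where
  rIn := 1 / (n + 1)
  rOut := 2 / (n + 1)
  rIn_pos := by positivity
  rIn_lt_rOut := by gcongr; norm_num

/-- The associated mollifiers. -/
noncomputable def mollifier (n : ℕ) : Space → ℝ := (bumpSeq n).normed volume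

theorem mollifier_isTestFunction (n : ℕ) : IsTestFunction (mollifier n) :=
  ⟨(bumpSeq n).contDiff_normed, (bumpSeq n).hasCompactSupport_normed⟩

theorem mollifier_nonneg (n : ℕ) (x : Space) : 0 ≤ mollifier n x := (bumpSeq n).nonneg_normed x

theorem integral_mollifier (n : ℕ) : ∫ x, mollifier n x = 1 := (bumpSeq n).integral_normed

theorem tendsto_smoothConv_mollifier {E : Type*} [NormedAddCommGroup E] [NormedSpace ℝ E]
    [CompleteSpace E] {f : Space → E} (hf : LocallyIntegrable f) :
    ∀ᵐ x, Tendsto (fun n => smoothConv volume (mollifier n) f x) atTop (𝓝 (f x)) := by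
  -- Convergence at Lebesgue points needs `rOut ≤ K * rIn`; the ratio of the radii is exactly `2`.
  refine ContDiffBump.ae_convolution_tendsto_right_of_locallyIntegrable (φ := bumpSeq) (K := 2)
    ?_ (Eventually.of_forall fun n => ?_) hf
  · have := (tendsto_one_div_add_atTop_nhds_zero_nat (𝕜 := ℝ)).const_mul 2
    simpa [bumpSeq, div_eq_mul_inv] using this
  · simp [bumpSeq, div_eq_mul_inv]

theorem integral_smoothConv_mollifier {f : Space → ℝ} (hf : Integrable f) (n : ℕ) :
    ∫ x, smoothConv volume (mollifier n) f x = ∫ x, f x := by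
  have h := mollifier_isTestFunction n
  rw [smoothConv, integral_convolution _ (h.1.continuous.integrable_of_hasCompactSupport h.2) hf,
    integral_mollifier]
  simp

theorem integrable_smoothConv_mollifier {f : Space → ℝ} (hf : Integrable f) (n : ℕ) :
    Integrable (smoothConv volume (mollifier n) f) :=
  have h := mollifier_isTestFunction n
  (h.1.continuous.integrable_of_hasCompactSupport h.2).integrable_convolution _ hf

/-! ### Integral identities for smooth maps -/

section Smooth

variable {E : Type*} [NormedAddCommGroup E] [InnerProductSpace ℝ E]

theorem HasCompactSupport.integrable_mul_continuous {ψ a : Space → ℝ} (hc : HasCompactSupport ψ)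
    (hψ : Continuous ψ) (ha : Continuous a) : Integrable fun x => ψ x * a x :=
  (hψ.mul ha).integrable_of_hasCompactSupport hc.mul_right

theorem integral_fderiv_mul_inner {ψ : Space → ℝ} (hψ : IsTestFunction ψ) {A B : Space → E}
    (hA : ContDiff ℝ 1 A) (hB : ContDiff ℝ 1 B) (v : Space) :
    ∫ x, (fderiv ℝ ψ x v * ⟪A x, B x⟫
      + ψ x * (⟪A x, fderiv ℝ B x v⟫ + ⟪fderiv ℝ A x v, B x⟫)) = 0 := by
  have hdA := hA.differentiable one_ne_zero
  have hdB := hB.differentiable one_ne_zero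
  have hdψ : Differentiable ℝ ψ := hψ.1.differentiable (by simp)
  have key : ∀ x, fderiv ℝ (fun x => ψ x * ⟪A x, B x⟫) x v = fderiv ℝ ψ x v * ⟪A x, B x⟫
      + ψ x * (⟪A x, fderiv ℝ B x v⟫ + ⟪fderiv ℝ A x v, B x⟫) := fun x => by
    rw [fderiv_fun_mul (hdψ x) ((hdA x).inner ℝ (hdB x))]
    simp only [add_apply, smul_apply,
      fderiv_inner_apply ℝ (hdA x) (hdB x), smul_eq_mul]
    ring
  have hcd : ContDiff ℝ 1 fun x => ψ x * ⟪A x, B x⟫ := (hψ.1.of_le (by simp)).mul (hA.inner ℝ hB)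
  have := integral_fderiv_apply_eq_zero (μ := volume) (v := v) (hcd.differentiable one_ne_zero)
    ((hcd.continuous_fderiv one_ne_zero).clm_apply continuous_const) hψ.2.mul_right
  simpa only [key] using this

theorem integrable_fderiv_mul_inner {ψ : Space → ℝ} (hψ : IsTestFunction ψ) {A B : Space → E}
    (hA : ContDiff ℝ 1 A) (hB : ContDiff ℝ 1 B) (v : Space) :
    Integrable fun x => (fderiv ℝ ψ x v * ⟪A x, B x⟫
      + ψ x * (⟪A x, fderiv ℝ B x v⟫ + ⟪fderiv ℝ A x v, B x⟫)) := by
  have hA' : Continuous fun x => fderiv ℝ A x v :=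
    (hA.continuous_fderiv one_ne_zero).clm_apply continuous_const
  have hB' : Continuous fun x => fderiv ℝ B x v :=
    (hB.continuous_fderiv one_ne_zero).clm_apply continuous_const
  have hψ' := hψ.fderiv_apply v
  exact (hψ'.2.integrable_mul_continuous hψ'.1.continuous
    (hA.continuous.inner hB.continuous)).add (hψ.2.integrable_mul_continuous hψ.1.continuous
    ((hA.continuous.inner hB').add (hA'.inner hB.continuous)))

/-- The stress-energy identity for a smooth map, tested with a vector field `X`. -/
theorem integral_stress_energy {D : Fin 3 → Space → E} (hD : ∀ i, ContDiff ℝ 1 (D i))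
    (hsymm : ∀ i j x, fderiv ℝ (D i) x (unitVec j) = fderiv ℝ (D j) x (unitVec i))
    {X : Fin 3 → Space → ℝ} (hX : ∀ i, IsTestFunction (X i)) :
    ∫ x, ((∑ i, ∑ j, fderiv ℝ (X j) x (unitVec i) * ⟪D i x, D j x⟫)
      - (1 / 2 : ℝ) * (∑ i, ∑ k, fderiv ℝ (X i) x (unitVec i) * ⟪D k x, D k x⟫)
      + ∑ j, X j x * ⟪∑ i, fderiv ℝ (D i) x (unitVec i), D j x⟫) = 0 := by
  have h1 := fun i j =>
    integrable_fderiv_mul_inner (hX j) (hD i) (hD j) (unitVec i)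
  have h2 := fun i k =>
    integrable_fderiv_mul_inner (hX i) (hD k) (hD k) (unitVec i)
  have e1 : ∫ x, ∑ i, ∑ j, (fderiv ℝ (X j) x (unitVec i) * ⟪D i x, D j x⟫
      + X j x * (⟪D i x, fderiv ℝ (D j) x (unitVec i)⟫
        + ⟪fderiv ℝ (D i) x (unitVec i), D j x⟫)) = 0 := by
    rw [integral_finsetSum _ fun i _ => integrable_finsetSum _ fun j _ => h1 i j]
    refine Finset.sum_eq_zero fun i _ => ?_
    rw [integral_finsetSum _ fun j _ => h1 i j]
    exact Finset.sum_eq_zero fun j _ => integral_fderiv_mul_inner (hX j) (hD i) (hD j) _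
  have e2 : ∫ x, ∑ i, ∑ k, (fderiv ℝ (X i) x (unitVec i) * ⟪D k x, D k x⟫
      + X i x * (⟪D k x, fderiv ℝ (D k) x (unitVec i)⟫
        + ⟪fderiv ℝ (D k) x (unitVec i), D k x⟫)) = 0 := by
    rw [integral_finsetSum _ fun i _ => integrable_finsetSum _ fun j _ => h2 i j]
    refine Finset.sum_eq_zero fun i _ => ?_
    rw [integral_finsetSum _ fun j _ => h2 i j]
    exact Finset.sum_eq_zero fun k _ => integral_fderiv_mul_inner (hX i) (hD k) (hD k) _
  have e3 := congrArg₂ (fun a b : ℝ => a - (1 / 2 : ℝ) * b) e1 e2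
  simp only [← integral_const_mul] at e3
  rw [← integral_sub (integrable_finsetSum _ fun i _ => integrable_finsetSum _ fun j _ => h1 i j)
    ((integrable_finsetSum _ fun i _ => integrable_finsetSum _ fun j _ => h2 i j).const_mul _)]
    at e3
  rw [mul_zero, sub_zero] at e3
  rw [← e3]
  congr 1 with x
  simp only [Finset.sum_add_distrib, mul_add, sum_inner, Finset.mul_sum]
  -- Symmetry of the second derivatives turns `Xⱼ⟪Dᵢ, ∂ᵢDⱼ⟫` into `Xⱼ⟪Dᵢ, ∂ⱼDᵢ⟫`, which cancels
  -- against half the derivative of `|D|²`.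
  have hs : ∑ i, ∑ j, X j x * ⟪D i x, fderiv ℝ (D j) x (unitVec i)⟫
      = ∑ i, ∑ k, X i x * ⟪D k x, fderiv ℝ (D k) x (unitVec i)⟫ := by
    rw [Finset.sum_comm]
    simp only [hsymm]
  have hs' : ∑ i, ∑ k, X i x * ⟪fderiv ℝ (D k) x (unitVec i), D k x⟫
      = ∑ i, ∑ k, X i x * ⟪D k x, fderiv ℝ (D k) x (unitVec i)⟫ := by
    simp only [real_inner_comm]
  have hs'' : ∑ i, ∑ j, X j x * ⟪fderiv ℝ (D i) x (unitVec i), D j x⟫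
      = ∑ j, ∑ i, X j x * ⟪fderiv ℝ (D i) x (unitVec i), D j x⟫ := Finset.sum_comm
  simp only [← Finset.mul_sum] at hs hs' hs'' ⊢
  rw [hs, hs', ← hs'']
  ring

theorem contDiff_comp_of_contDiffOn {F : E → ℝ} {s : Set E}
    (hF : ContDiffOn ℝ 1 F s) {u : Space → E} (hu : ContDiff ℝ 1 u) (hus : ∀ x, u x ∈ s) :
    ContDiff ℝ 1 fun x => F (u x) := by
  rw [← contDiffOn_univ] at hu ⊢
  exact hF.comp hu fun x _ => hus x

/-- The map `u` may touch the boundary of `s`, where only the derivative within `s` is meaningful;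
the chain rule survives because all values of `u` lie in `s`. -/
theorem fderiv_comp_within_apply {F : E → ℝ} {s : Set E}
    (hF : ContDiffOn ℝ 1 F s) {u : Space → E} (hu : Differentiable ℝ u) (hus : ∀ x, u x ∈ s)
    (x v : Space) :
    fderiv ℝ (fun x => F (u x)) x v = fderivWithin ℝ F s (u x) (fderiv ℝ u x v) := by
  have h1 := (hF.differentiableOn one_ne_zero (u x) (hus x)).hasFDerivWithinAt
  have := (h1.comp_hasFDerivAt x (hu x).hasFDerivAt (Eventually.of_forall hus)).fderiv
  rw [show (fun x => F (u x)) = F ∘ u from rfl, this]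
  rfl

/-- Integration by parts for a potential composed with a smooth map into its domain. -/
theorem integral_potential {F : E → ℝ} {s : Set E}
    (hF : ContDiffOn ℝ 1 F s) {u : Space → E} (hu : ContDiff ℝ 1 u) (hus : ∀ x, u x ∈ s)
    {X : Fin 3 → Space → ℝ} (hX : ∀ i, IsTestFunction (X i)) :
    ∫ x, ((∑ j, fderiv ℝ (X j) x (unitVec j) * F (u x))
      + ∑ j, X j x * fderivWithin ℝ F s (u x) (fderiv ℝ u x (unitVec j))) = 0 := by
  have hFu := contDiff_comp_of_contDiffOn hF hu hus
  have hcd : ∀ j, ContDiff ℝ 1 fun x => X j x * F (u x) := fun j =>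
    ((hX j).1.of_le (by simp)).mul hFu
  have hc : ∀ j, HasCompactSupport fun x => X j x * F (u x) := fun j => (hX j).2.mul_right
  have hcont : ∀ j, Continuous fun x => fderiv ℝ (fun x => X j x * F (u x)) x (unitVec j) :=
    fun j => ((hcd j).continuous_fderiv one_ne_zero).clm_apply continuous_const
  have h0 : ∫ x, ∑ j, fderiv ℝ (fun x => X j x * F (u x)) x (unitVec j) = 0 := by
    rw [integral_finsetSum _ fun j _ => (hcont j).integrable_of_hasCompactSupport
      ((hc j).fderiv_apply (𝕜 := ℝ) _)]
    exact Finset.sum_eq_zero fun j _ =>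
      integral_fderiv_apply_eq_zero ((hcd j).differentiable one_ne_zero) (hcont j) (hc j)
  rw [← h0]
  congr 1 with x
  rw [← Finset.sum_add_distrib]
  refine Finset.sum_congr rfl fun j _ => ?_
  rw [fderiv_fun_mul ((hX j).1.differentiable (by simp) x) (hFu.differentiable one_ne_zero x)]
  simp only [add_apply, smul_apply, smul_eq_mul,
    fderiv_comp_within_apply hF (hu.differentiable one_ne_zero) hus]
  ring

end Smooth

/-! ### Passage to the limit in the mollified identities -/

section DominatedTerms

variable {α : Type*} [MeasurableSpace α] {μ : Measure α}
  {E : Type*} [NormedAddCommGroup E]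
  {b : ℕ → α → ℝ} {ψ κ : α → ℝ} {M C : ℝ}

theorem dominatedLimit_mul_inner [InnerProductSpace ℝ E] {A B : ℕ → α → E} {A' B' : α → E}
    (hψ : AEStronglyMeasurable ψ μ) (hM : ∀ x, |ψ x| ≤ M)
    (hA : ∀ n, AEStronglyMeasurable (A n) μ) (hB : ∀ n, AEStronglyMeasurable (B n) μ)
    (hAb : ∀ n x, ‖A n x‖ ^ 2 ≤ b n x) (hBb : ∀ n x, ‖B n x‖ ^ 2 ≤ b n x)
    (hAlim : ∀ᵐ x ∂μ, Tendsto (fun n => A n x) atTop (𝓝 (A' x)))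
    (hBlim : ∀ᵐ x ∂μ, Tendsto (fun n => B n x) atTop (𝓝 (B' x))) :
    DominatedLimit μ b (fun n x => ψ x * ⟪A n x, B n x⟫) (fun x => ψ x * ⟪A' x, B' x⟫) := by
  refine ⟨fun n => hψ.mul ((hA n).inner (hB n)), ⟨M, fun n => Eventually.of_forall fun x => ?_⟩, ?_⟩
  · rw [abs_mul]
    refine mul_le_mul (hM x) ?_ (abs_nonneg _) ((abs_nonneg _).trans (hM x))
    have h1 := abs_real_inner_le_norm (A n x) (B n x)
    have h2 := two_mul_le_add_sq ‖A n x‖ ‖B n x‖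
    linarith [hAb n x, hBb n x]
  · filter_upwards [hAlim, hBlim] with x h1 h2 using (h1.inner h2).const_mul _

/-- For terms linear in the gradient: `κ‖A‖ ≤ κ + ‖A‖²` since `0 ≤ κ ≤ 1`. In the application `κ` is
the indicator of a compact set carrying the test fields. -/
theorem dominatedLimit_mul_of_le_norm {A : ℕ → α → E} {s : ℕ → α → ℝ} {s' : α → ℝ}
    (hψ : AEStronglyMeasurable ψ μ) (hM : ∀ x, |ψ x| ≤ M * κ x) (hM0 : 0 ≤ M) (hC0 : 0 ≤ C)
    (hκ0 : ∀ x, 0 ≤ κ x) (hκ1 : ∀ x, κ x ≤ 1) (hs : ∀ n, AEStronglyMeasurable (s n) μ)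
    (hsA : ∀ n x, |s n x| ≤ C * ‖A n x‖) (hAb : ∀ n x, κ x + ‖A n x‖ ^ 2 ≤ b n x)
    (hlim : ∀ᵐ x ∂μ, Tendsto (fun n => s n x) atTop (𝓝 (s' x))) :
    DominatedLimit μ b (fun n x => ψ x * s n x) (fun x => ψ x * s' x) := by
  refine ⟨fun n => hψ.mul (hs n), ⟨M * C, fun n => Eventually.of_forall fun x => ?_⟩, ?_⟩
  · have h1 : κ x * ‖A n x‖ ≤ b n x := by
      have := hκ0 x
      have := hκ1 x
      nlinarith [hAb n x, sq_nonneg (κ x - ‖A n x‖), norm_nonneg (A n x)]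
    calc |ψ x * s n x| = |ψ x| * |s n x| := abs_mul _ _
      _ ≤ (M * κ x) * (C * ‖A n x‖) :=
        mul_le_mul (hM x) (hsA n x) (abs_nonneg _) (mul_nonneg hM0 (hκ0 x))
      _ = (M * C) * (κ x * ‖A n x‖) := by ring
      _ ≤ _ := mul_le_mul_of_nonneg_left h1 (mul_nonneg hM0 hC0)
  · filter_upwards [hlim] with x h1 using h1.const_mul _

theorem dominatedLimit_mul_of_bounded {s : ℕ → α → ℝ} {s' : α → ℝ}
    (hψ : AEStronglyMeasurable ψ μ) (hM : ∀ x, |ψ x| ≤ M * κ x) (hM0 : 0 ≤ M)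
    (hC0 : 0 ≤ C) (hκ0 : ∀ x, 0 ≤ κ x) (hs : ∀ n, AEStronglyMeasurable (s n) μ)
    (hsC : ∀ n x, |s n x| ≤ C) (hb : ∀ n x, κ x ≤ b n x)
    (hlim : ∀ᵐ x ∂μ, Tendsto (fun n => s n x) atTop (𝓝 (s' x))) :
    DominatedLimit μ b (fun n x => ψ x * s n x) (fun x => ψ x * s' x) := by
  refine ⟨fun n => hψ.mul (hs n), ⟨M * C, fun n => Eventually.of_forall fun x => ?_⟩, ?_⟩
  · calc |ψ x * s n x| = |ψ x| * |s n x| := abs_mul _ _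
      _ ≤ (M * κ x) * C :=
        mul_le_mul (hM x) (hsC n x) (abs_nonneg _) (mul_nonneg hM0 (hκ0 x))
      _ = (M * C) * κ x := by ring
      _ ≤ _ := mul_le_mul_of_nonneg_left (hb n x) (mul_nonneg hM0 hC0)
  · filter_upwards [hlim] with x h1 using h1.const_mul _

end DominatedTerms

/-- Finitely many test functions and their derivatives are bounded by a multiple of the indicator
function of a common compact set. -/
theorem exists_compact_bound_testFunctions {X : Fin 3 → Space → ℝ}
    (hX : ∀ i, IsTestFunction (X i)) :
    ∃ (K : Set Space) (M : ℝ), IsCompact K ∧ 0 ≤ M ∧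
      (∀ i x, |X i x| ≤ M * K.indicator (fun _ => (1 : ℝ)) x) ∧
      ∀ i j x, |fderiv ℝ (X i) x (unitVec j)| ≤ M * K.indicator (fun _ => (1 : ℝ)) x := by
  have hb1 : ∀ i, ∃ C, ∀ x, ‖X i x‖ ≤ C := fun i =>
    (hX i).2.exists_bound_of_continuous (hX i).1.continuous
  have hb2 : ∀ i j, ∃ C, ∀ x, ‖fderiv ℝ (X i) x (unitVec j)‖ ≤ C := fun i j =>
    ((hX i).fderiv_apply _).2.exists_bound_of_continuous ((hX i).fderiv_apply _).1.continuous
  choose C hC using hb1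
  choose C' hC' using hb2
  have hC0 : ∀ i, 0 ≤ C i := fun i => (norm_nonneg _).trans (hC i 0)
  have hC'0 : ∀ i j, 0 ≤ C' i j := fun i j => (norm_nonneg _).trans (hC' i j 0)
  have hs1 : 0 ≤ ∑ i, C i := Finset.sum_nonneg fun i _ => hC0 i
  have hs2 : 0 ≤ ∑ i, ∑ j, C' i j :=
    Finset.sum_nonneg fun i _ => Finset.sum_nonneg fun j _ => hC'0 i j
  refine ⟨⋃ i, tsupport (X i), (∑ i, C i) + ∑ i, ∑ j, C' i j,
    isCompact_iUnion fun i => (hX i).2, by positivity, fun i x => ?_, fun i j x => ?_⟩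
  · by_cases hx : x ∈ ⋃ i, tsupport (X i)
    · rw [Set.indicator_of_mem hx, mul_one]
      have := Finset.single_le_sum (f := C) (fun i _ => hC0 i) (Finset.mem_univ i)
      exact (hC i x).trans (by linarith)
    · rw [Set.indicator_of_notMem hx, mul_zero,
        image_eq_zero_of_notMem_tsupport fun h => hx (Set.mem_iUnion.2 ⟨i, h⟩), abs_zero]
  · by_cases hx : x ∈ ⋃ i, tsupport (X i)
    · rw [Set.indicator_of_mem hx, mul_one]
      have h1 := Finset.single_le_sum (f := C' i) (fun j _ => hC'0 i j) (Finset.mem_univ j)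
      have h2 := Finset.single_le_sum (f := fun i => ∑ j, C' i j)
        (fun i _ => Finset.sum_nonneg fun j _ => hC'0 i j) (Finset.mem_univ i)
      exact (hC' i j x).trans (by linarith)
    · rw [Set.indicator_of_notMem hx, mul_zero, fderiv_of_notMem_tsupport ℝ
        fun h => hx (Set.mem_iUnion.2 ⟨i, h⟩)]
      simp

section InnerVariation

variable {E : Type*} [NormedAddCommGroup E] [InnerProductSpace ℝ E] [FiniteDimensional ℝ E]

/-- The inner variation identity: a bounded weak solution `Q` of `ΔQ = g`, where `g` represents
the gradient of a potential `F` in the directions of the derivatives of `Q`, is stationary with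
respect to smooth compactly supported deformations of the domain. -/
theorem integral_inner_variation {F : E → ℝ} {r : ℝ} (hr : 0 < r)
    (hF : ContDiffOn ℝ 1 F (closedBall 0 r)) {Q g : Space → E} {G : Fin 3 → Space → E}
    (hQ : LocallyIntegrable Q) (hg : LocallyIntegrable g) (hG : ∀ i, LocallyIntegrable (G i))
    (hQr : ∀ᵐ x, ‖Q x‖ ≤ r) {Cg : ℝ} (hgC : ∀ᵐ x, ‖g x‖ ≤ Cg)
    (hw : ∀ i, HasWeakDeriv (unitVec i) Q (G i))
    (hsol : ∀ φ : Space → ℝ, IsTestFunction φ →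
      (∫ x, (- Laplacian.laplacian φ x) • Q x) + ∫ x, φ x • g x = 0)
    (hinner : ∀ i, ∀ᵐ x, ⟪g x, G i x⟫ = fderivWithin ℝ F (closedBall 0 r) (Q x) (G i x))
    (hG2 : Integrable fun x => ∑ i, ‖G i x‖ ^ 2)
    {X : Fin 3 → Space → ℝ} (hX : ∀ i, IsTestFunction (X i)) :
    ∫ x, ((∑ i, ∑ j, fderiv ℝ (X j) x (unitVec i) * ⟪G i x, G j x⟫)
      - (1 / 2 : ℝ) * (∑ i, ∑ k, fderiv ℝ (X i) x (unitVec i) * ⟪G k x, G k x⟫)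
      - ∑ j, fderiv ℝ (X j) x (unitVec j) * F (Q x)) = 0 := by
  set s : Set E := closedBall 0 r with hs
  set u : ℕ → Space → E := fun n => smoothConv volume (mollifier n) Q with hu
  set D : Fin 3 → ℕ → Space → E := fun i n => smoothConv volume (mollifier n) (G i) with hD
  set gn : ℕ → Space → E := fun n => smoothConv volume (mollifier n) g with hgn
  have hρ := mollifier_isTestFunction
  have hucd : ∀ n, ContDiff ℝ ∞ (u n) := fun n => contDiff_smoothConv (hρ n).1 (hρ n).2 hQ
  have hDcd : ∀ i n, ContDiff ℝ ∞ (D i n) := fun i n =>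
    contDiff_smoothConv (hρ n).1 (hρ n).2 (hG i)
  have hgcd : ∀ n, ContDiff ℝ ∞ (gn n) := fun n => contDiff_smoothConv (hρ n).1 (hρ n).2 hg
  have huD : ∀ i n x, fderiv ℝ (u n) x (unitVec i) = D i n x := fun i n x =>
    (hw i).fderiv_smoothConv hQ (hρ n) x
  have hus : ∀ n x, u n x ∈ s := fun n x => by
    rw [hs, mem_closedBall_zero_iff]
    exact norm_smoothConv_le (hρ n).1.continuous (hρ n).2 (mollifier_nonneg n)
      (integral_mollifier n) hQr x
  have hgnC : ∀ n x, ‖gn n x‖ ≤ Cg := fun n x =>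
    norm_smoothConv_le (hρ n).1.continuous (hρ n).2 (mollifier_nonneg n)
      (integral_mollifier n) hgC x
  have hCg0 : 0 ≤ Cg := (norm_nonneg _).trans (hgnC 0 0)
  have hsymm : ∀ n i j x, fderiv ℝ (D i n) x (unitVec j) = fderiv ℝ (D j n) x (unitVec i) := by
    intro n i j x
    have hd : DifferentiableAt ℝ (fderiv ℝ (u n)) x :=
      (((hucd n).fderiv_right (m := ∞) (by simp)).differentiable (by simp)) x
    have key : ∀ i j, fderiv ℝ (D i n) x (unitVec j)
        = fderiv ℝ (fderiv ℝ (u n)) x (unitVec j) (unitVec i) := fun i j => by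
      have : D i n = fun x => fderiv ℝ (u n) x (unitVec i) := funext fun x => (huD i n x).symm
      rw [this, fderiv_clm_apply hd (differentiableAt_const _)]
      simp
    rw [key, key]
    exact ((hucd n).contDiffAt.isSymmSndFDerivAt
      (by simpa using WithTop.coe_le_coe.2 (le_top : (2 : ℕ∞) ≤ ⊤))) _ _
  have hlap : ∀ n x, ∑ i, fderiv ℝ (D i n) x (unitVec i) = gn n x := fun n x =>
    sum_fderiv_smoothConv_of_weak_poisson hQ hG hw hsol (hρ n) x
  obtain ⟨K, M, hK, hM0, hXM, hX'M⟩ := exists_compact_bound_testFunctions hX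
  set κ : Space → ℝ := K.indicator fun _ => (1 : ℝ) with hκ
  have hκ0 : ∀ x, 0 ≤ κ x := fun x => Set.indicator_nonneg (fun _ _ => zero_le_one) x
  have hκ1 : ∀ x, κ x ≤ 1 := fun x => Set.indicator_le_self' (fun _ _ => zero_le_one) x
  have hκint : Integrable κ :=
    (integrable_indicator_iff hK.measurableSet).2 (integrableOn_const hK.measure_lt_top.ne)
  set e : Space → ℝ := fun x => ∑ i, ‖G i x‖ ^ 2 with he
  -- By Jensen, the mollified energy density dominates the quadratic terms; `κ` is added for the
  -- terms that are bounded or linear in the gradient.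
  set b : ℕ → Space → ℝ := fun n x => κ x + smoothConv volume (mollifier n) e x with hb
  have hGi2 : ∀ i, Integrable fun x => ‖G i x‖ ^ 2 := fun i => by
    refine hG2.mono' ((hG i).aestronglyMeasurable.norm.pow 2) (Eventually.of_forall fun x => ?_)
    rw [Real.norm_of_nonneg (sq_nonneg _)]
    exact Finset.single_le_sum (f := fun i => ‖G i x‖ ^ 2) (fun i _ => sq_nonneg _)
      (Finset.mem_univ i)
  have hDe : ∀ i n x, ‖D i n x‖ ^ 2 ≤ smoothConv volume (mollifier n) e x := fun i n x => by
    refine (norm_sq_smoothConv_le (hρ n).1.continuous (hρ n).2 (mollifier_nonneg n)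
      (integral_mollifier n) (hG i) (hGi2 i).locallyIntegrable x).trans ?_
    rw [smoothConv_apply, smoothConv_apply]
    refine integral_mono (smoothConv_integrable (hρ n).1.continuous (hρ n).2
      (hGi2 i).locallyIntegrable x) (smoothConv_integrable (hρ n).1.continuous (hρ n).2
      hG2.locallyIntegrable x) fun y => ?_
    exact mul_le_mul_of_nonneg_left (Finset.single_le_sum (f := fun i => ‖G i y‖ ^ 2)
      (fun i _ => sq_nonneg _) (Finset.mem_univ i)) (mollifier_nonneg n _)
  have hDb : ∀ i n x, κ x + ‖D i n x‖ ^ 2 ≤ b n x := fun i n x => by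
    simp only [hb]; linarith [hDe i n x]
  have hDb' : ∀ i n x, ‖D i n x‖ ^ 2 ≤ b n x := fun i n x => by linarith [hDb i n x, hκ0 x]
  have hκb : ∀ n x, κ x ≤ b n x := fun n x => by linarith [hDb 0 n x, sq_nonneg ‖D 0 n x‖]
  have hbint : ∀ n, Integrable (b n) := fun n =>
    hκint.add (integrable_smoothConv_mollifier hG2 n)
  have hbB : ∀ᵐ x, Tendsto (fun n => b n x) atTop (𝓝 (κ x + e x)) := by
    filter_upwards [tendsto_smoothConv_mollifier hG2.locallyIntegrable] with x hx
    exact hx.const_add _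
  have hbB' : Tendsto (fun n => ∫ x, b n x) atTop (𝓝 (∫ x, (κ x + e x))) := by
    -- The mollifiers have mass one, so `∫ b n` is independent of `n`.
    refine tendsto_const_nhds.congr fun n => ?_
    rw [integral_add hκint hG2, integral_add hκint (integrable_smoothConv_mollifier hG2 n),
      integral_smoothConv_mollifier hG2]
  have hDlim : ∀ i, ∀ᵐ x, Tendsto (fun n => D i n x) atTop (𝓝 (G i x)) := fun i =>
    tendsto_smoothConv_mollifier (hG i)
  have hulim : ∀ᵐ x, Tendsto (fun n => u n x) atTop (𝓝[s] Q x) := by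
    filter_upwards [tendsto_smoothConv_mollifier hQ] with x hx
    exact tendsto_nhdsWithin_iff.2 ⟨hx, Eventually.of_forall fun n => hus n x⟩
  have hQs : ∀ᵐ x, Q x ∈ s := by
    filter_upwards [hQr] with x hx
    rwa [hs, mem_closedBall_zero_iff]
  have huniq : UniqueDiffOn ℝ s :=
    uniqueDiffOn_convex (convex_closedBall 0 r)
      ⟨0, ball_subset_interior_closedBall (mem_ball_self hr)⟩
  have hscomp : IsCompact s := isCompact_closedBall 0 r
  have hFc : ContinuousOn F s := hF.continuousOn
  have hF'c : ContinuousOn (fderivWithin ℝ F s) s :=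
    hF.continuousOn_fderivWithin huniq le_rfl
  obtain ⟨C₀, hC₀⟩ := hscomp.exists_bound_of_continuousOn hFc
  obtain ⟨C₁, hC₁⟩ := hscomp.exists_bound_of_continuousOn hF'c
  have hC₀0 : 0 ≤ C₀ := (norm_nonneg _).trans (hC₀ _ (hus 0 0))
  have hC₁0 : 0 ≤ C₁ := (norm_nonneg _).trans (hC₁ _ (hus 0 0))
  have hb0 : ∀ n x, 0 ≤ b n x := fun n x => (hκ0 x).trans (hκb n x)
  have hX'm : ∀ i j, Continuous fun x => fderiv ℝ (X i) x (unitVec j) := fun i j =>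
    ((hX i).fderiv_apply _).1.continuous
  have hX'M1 : ∀ i j x, |fderiv ℝ (X i) x (unitVec j)| ≤ M := fun i j x =>
    (hX'M i j x).trans (mul_le_of_le_one_right hM0 (hκ1 x))
  have hDm : ∀ i n, AEStronglyMeasurable (D i n) := fun i n =>
    (hDcd i n).continuous.aestronglyMeasurable
  have t1 : ∀ i j k l, DominatedLimit volume b
      (fun n x => fderiv ℝ (X i) x (unitVec j) * ⟪D k n x, D l n x⟫)
      (fun x => fderiv ℝ (X i) x (unitVec j) * ⟪G k x, G l x⟫) := fun i j k l =>
    dominatedLimit_mul_inner (hX'm i j).aestronglyMeasurable (hX'M1 i j) (hDm k) (hDm l)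
      (hDb' k) (hDb' l) (hDlim k) (hDlim l)
  have t2 : ∀ j, DominatedLimit volume b
      (fun n x => X j x * ⟪gn n x, D j n x⟫) (fun x => X j x * ⟪g x, G j x⟫) := fun j => by
    refine dominatedLimit_mul_of_le_norm (A := D j) (C := Cg)
      (hX j).1.continuous.aestronglyMeasurable (hXM j) hM0 hCg0 hκ0 hκ1
      (fun n => (hgcd n).continuous.aestronglyMeasurable.inner (hDm j n)) (fun n x => ?_)
      (hDb j) ?_
    · exact (abs_real_inner_le_norm _ _).trans
        (mul_le_mul_of_nonneg_right (hgnC n x) (norm_nonneg _))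
    · filter_upwards [tendsto_smoothConv_mollifier hg, hDlim j] with x h1 h2 using h1.inner h2
  have t3 : ∀ j, DominatedLimit volume b
      (fun n x => fderiv ℝ (X j) x (unitVec j) * F (u n x))
      (fun x => fderiv ℝ (X j) x (unitVec j) * F (Q x)) := fun j => by
    refine dominatedLimit_mul_of_bounded (hX'm j j).aestronglyMeasurable (hX'M j j) hM0 hC₀0 hκ0
      (fun n => (hFc.comp_continuous (hucd n).continuous (hus n)).aestronglyMeasurable)
      (fun n x => hC₀ _ (hus n x)) hκb ?_
    filter_upwards [hulim, hQs] with x h1 h2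
    exact (hFc _ h2).tendsto.comp h1
  have t4 : ∀ j, DominatedLimit volume b
      (fun n x => X j x * fderivWithin ℝ F s (u n x) (D j n x))
      (fun x => X j x * fderivWithin ℝ F s (Q x) (G j x)) := fun j => by
    refine dominatedLimit_mul_of_le_norm (A := D j) (C := C₁)
      (hX j).1.continuous.aestronglyMeasurable (hXM j) hM0 hC₁0 hκ0 hκ1
      (fun n => ?_) (fun n x => ?_) (hDb j) ?_
    · exact ((hF'c.comp_continuous (hucd n).continuous (hus n)).clm_apply
        (hDcd j n).continuous).aestronglyMeasurable
    · exact (ContinuousLinearMap.le_opNorm _ _).trans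
        (mul_le_mul_of_nonneg_right (hC₁ _ (hus n x)) (norm_nonneg _))
    · filter_upwards [hulim, hQs, hDlim j] with x h1 h2 h3
      have h4 : Tendsto (fun n => fderivWithin ℝ F s (u n x)) atTop (𝓝 (fderivWithin ℝ F s (Q x))) :=
        (hF'c _ h2).tendsto.comp h1
      exact (isBoundedBilinearMap_apply.continuous.tendsto (fderivWithin ℝ F s (Q x), G j x)).comp
        (h4.prodMk_nhds h3)
  have d1 := ((DominatedLimit.sum Finset.univ fun i _ => DominatedLimit.sum Finset.univ
    fun j _ => t1 j i i j).sub ((DominatedLimit.sum Finset.univ fun i _ =>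
      DominatedLimit.sum Finset.univ fun k _ => t1 i i k k).const_mul (1 / 2))).add
    (DominatedLimit.sum Finset.univ fun j _ => t2 j)
  have d2 := (DominatedLimit.sum Finset.univ fun j _ => t3 j).add
    (DominatedLimit.sum Finset.univ fun j _ => t4 j)
  have d3 := d1.sub d2
  have l3 := d3.tendsto_integral hbint (hκint.add hG2) hbB hbB'
  have z1 : ∀ n, ∫ x, ((∑ i, ∑ j, fderiv ℝ (X j) x (unitVec i) * ⟪D i n x, D j n x⟫)
      - (1 / 2 : ℝ) * (∑ i, ∑ k, fderiv ℝ (X i) x (unitVec i) * ⟪D k n x, D k n x⟫)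
      + ∑ j, X j x * ⟪gn n x, D j n x⟫) = 0 := fun n => by
    have := integral_stress_energy (D := fun i => D i n)
      (fun i => (hDcd i n).of_le (by simp)) (hsymm n) hX
    simpa only [hlap] using this
  have z2 : ∀ n, ∫ x, ((∑ j, fderiv ℝ (X j) x (unitVec j) * F (u n x))
      + ∑ j, X j x * fderivWithin ℝ F s (u n x) (D j n x)) = 0 := fun n => by
    have := integral_potential hF ((hucd n).of_le (by simp)) (hus n) hX
    simpa only [huD] using this
  have z3 : ∀ n, ∫ x, (_ - _) = (0 : ℝ) := fun n =>
    (integral_sub (d1.integrable hbint n) (d2.integrable hbint n)).trans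
      (by rw [z1, z2, sub_zero])
  have l4 := tendsto_nhds_unique (tendsto_const_nhds.congr fun n => (z3 n).symm) l3
  rw [l4]
  refine integral_congr_ae ?_
  -- Only here, in the limit, do the two terms carrying an undifferentiated `X j` cancel.
  filter_upwards [ae_all_iff.2 hinner] with x hx
  simp only [hx]
  ring

end InnerVariation

/-! ### The Pohozaev identity -/

/-- The components of the radial vector field `x`, cut off outside a ball. -/
noncomputable def cutoffCoord (j : Fin 3) (x : Space) : ℝ :=
  x j * (⟨1, 2, one_pos, one_lt_two⟩ : ContDiffBump (0 : Space)) x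

theorem cutoffCoord_isTestFunction (j : Fin 3) : IsTestFunction (cutoffCoord j) :=
  ⟨(EuclideanSpace.proj (𝕜 := ℝ) j).contDiff.mul (ContDiffBump.contDiff _),
    (ContDiffBump.hasCompactSupport _).mul_left⟩

theorem fderiv_cutoffCoord_zero (i j : Fin 3) :
    fderiv ℝ (cutoffCoord j) 0 (unitVec i) = if i = j then 1 else 0 := by
  have h : cutoffCoord j =ᶠ[𝓝 0] (EuclideanSpace.proj j : Space →L[ℝ] ℝ) := by
    filter_upwards [(⟨1, 2, one_pos, one_lt_two⟩ : ContDiffBump (0 : Space)).eventuallyEq_one]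
      with x hx
    simp [cutoffCoord, hx]
  rw [h.fderiv_eq, ContinuousLinearMap.fderiv]
  simp [eq_comm]

/-- The dilation `c ψ (x / c)` of a test function. -/
theorem IsTestFunction.dilate {ψ : Space → ℝ} (h : IsTestFunction ψ) {c : ℝ} (hc : c ≠ 0) :
    IsTestFunction fun x => c * ψ (c⁻¹ • x) :=
  ⟨contDiff_const.mul (h.1.comp (contDiff_const_smul c⁻¹)),
    (h.2.comp_homeomorph (Homeomorph.smulOfNeZero c⁻¹ (inv_ne_zero hc))).mul_left⟩

/-- The factor `c` is chosen to make the derivative scale invariant: its bounds are uniform in `c`,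
and as `c → ∞` it tends pointwise to its value at the origin. -/
theorem fderiv_dilate_apply {ψ : Space → ℝ} (h : Differentiable ℝ ψ) {c : ℝ} (hc : c ≠ 0)
    (x v : Space) :
    fderiv ℝ (fun x => c * ψ (c⁻¹ • x)) x v = fderiv ℝ ψ (c⁻¹ • x) v := by
  have h1 : HasFDerivAt (fun z : Space => c⁻¹ • z) (c⁻¹ • ContinuousLinearMap.id ℝ Space) x :=
    (hasFDerivAt_id x).const_smul c⁻¹
  have := (((h (c⁻¹ • x)).hasFDerivAt.comp x h1).const_mul c).fderiv
  rw [show (fun x => c * ψ (c⁻¹ • x)) = fun y => c * (ψ ∘ fun z => c⁻¹ • z) y from rfl, this]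
  simp [hc]

theorem dominatedLimit_weight_mul {α : Type*} [MeasurableSpace α] {μ : Measure α}
    {w : ℕ → α → ℝ} {M c : ℝ} (hw : ∀ n, AEStronglyMeasurable (w n) μ)
    (hM : ∀ n x, |w n x| ≤ M) (hlim : ∀ x, Tendsto (fun n => w n x) atTop (𝓝 c))
    {a B : α → ℝ} (ha : AEStronglyMeasurable a μ) (haB : ∀ x, |a x| ≤ B x) :
    DominatedLimit μ (fun _ => B) (fun n x => w n x * a x) (fun x => c * a x) := by
  refine ⟨fun n => (hw n).mul ha, ⟨M, fun n => Eventually.of_forall fun x => ?_⟩,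
    Eventually.of_forall fun x => (hlim x).mul_const _⟩
  rw [abs_mul]
  exact mul_le_mul (hM n x) (haB x) (abs_nonneg _) ((abs_nonneg _).trans (hM n x))

section Pohozaev

variable {E : Type*} [NormedAddCommGroup E] [InnerProductSpace ℝ E]

/-- Bounded weak solutions of `ΔQ = ∂F(Q)` on `ℝ³` with finite energy satisfy the Pohozaev
identity. -/
theorem pohozaev_identity [FiniteDimensional ℝ E] {F : E → ℝ} {r : ℝ} (hr : 0 < r)
    (hF : ContDiffOn ℝ 1 F (closedBall 0 r)) {Q g : Space → E} {G : Fin 3 → Space → E}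
    (hQ : LocallyIntegrable Q) (hg : LocallyIntegrable g) (hG : ∀ i, LocallyIntegrable (G i))
    (hQr : ∀ᵐ x, ‖Q x‖ ≤ r) {Cg : ℝ} (hgC : ∀ᵐ x, ‖g x‖ ≤ Cg)
    (hw : ∀ i, HasWeakDeriv (unitVec i) Q (G i))
    (hsol : ∀ φ : Space → ℝ, IsTestFunction φ →
      (∫ x, (- Laplacian.laplacian φ x) • Q x) + ∫ x, φ x • g x = 0)
    (hinner : ∀ i, ∀ᵐ x, ⟪g x, G i x⟫ = fderivWithin ℝ F (closedBall 0 r) (Q x) (G i x))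
    (hG2 : Integrable fun x => ∑ i, ‖G i x‖ ^ 2) (hFQ : Integrable fun x => F (Q x)) :
    ∫ x, ((1 / 2 : ℝ) * (∑ i, ‖G i x‖ ^ 2) + 3 * F (Q x)) = 0 := by
  set R : ℕ → ℝ := fun n => n + 1 with hR
  have hR0 : ∀ n, R n ≠ 0 := fun n => by positivity
  set w : Fin 3 → Fin 3 → ℕ → Space → ℝ := fun j i n x =>
    fderiv ℝ (cutoffCoord j) ((R n)⁻¹ • x) (unitVec i) with hwdef
  have hY := cutoffCoord_isTestFunction
  have hcont : ∀ i j, Continuous fun x => fderiv ℝ (cutoffCoord j) x (unitVec i) := fun i j =>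
    ((hY j).fderiv_apply _).1.continuous
  have hwm : ∀ j i n, AEStronglyMeasurable (w j i n) := fun j i n =>
    ((hcont i j).comp (continuous_const_smul _)).aestronglyMeasurable
  have hbd : ∀ i j, ∃ C, ∀ x, ‖fderiv ℝ (cutoffCoord j) x (unitVec i)‖ ≤ C := fun i j =>
    ((hY j).fderiv_apply _).2.exists_bound_of_continuous (hcont i j)
  choose M hM using hbd
  have hwM : ∀ j i n x, |w j i n x| ≤ M i j := fun j i n x => hM i j _
  have hwlim : ∀ j i x, Tendsto (fun n => w j i n x) atTop (𝓝 (if i = j then 1 else 0)) := by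
    intro j i x
    have h0 : Tendsto (fun n => (R n)⁻¹ • x) atTop (𝓝 0) := by
      have := (tendsto_one_div_add_atTop_nhds_zero_nat (𝕜 := ℝ)).smul_const x
      simpa [hR] using this
    have := ((hcont i j).tendsto 0).comp h0
    rwa [fderiv_cutoffCoord_zero] at this
  set B : Space → ℝ := fun x => (∑ i, ‖G i x‖ ^ 2) + |F (Q x)| with hB
  have hBint : Integrable B := hG2.add hFQ.abs
  have hsingle : ∀ i x, ‖G i x‖ ^ 2 ≤ B x := fun i x => by
    have := Finset.single_le_sum (f := fun i => ‖G i x‖ ^ 2) (fun i _ => sq_nonneg _)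
      (Finset.mem_univ i)
    simp only [hB]
    linarith [abs_nonneg (F (Q x))]
  have hGB : ∀ i j x, |⟪G i x, G j x⟫| ≤ B x := fun i j x => by
    have h1 := abs_real_inner_le_norm (G i x) (G j x)
    have h2 := two_mul_le_add_sq ‖G i x‖ ‖G j x‖
    linarith [hsingle i x, hsingle j x]
  have hFB : ∀ x, |F (Q x)| ≤ B x := fun x =>
    le_add_of_nonneg_left (Finset.sum_nonneg fun i _ => sq_nonneg _)
  have t1 : ∀ j i k l, DominatedLimit volume (fun _ => B)
      (fun n x => w j i n x * ⟪G k x, G l x⟫)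
      (fun x => (if i = j then 1 else 0) * ⟪G k x, G l x⟫) := fun j i k l =>
    dominatedLimit_weight_mul (hwm j i) (hwM j i) (hwlim j i)
      ((hG k).aestronglyMeasurable.inner (hG l).aestronglyMeasurable) (hGB k l)
  have t2 : ∀ j, DominatedLimit volume (fun _ => B) (fun n x => w j j n x * F (Q x))
      (fun x => (if j = j then 1 else 0) * F (Q x)) := fun j =>
    dominatedLimit_weight_mul (hwm j j) (hwM j j) (hwlim j j) hFQ.1 hFB
  have d := ((DominatedLimit.sum Finset.univ fun i _ => DominatedLimit.sum Finset.univ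
    fun j _ => t1 j i i j).sub ((DominatedLimit.sum Finset.univ fun i _ =>
      DominatedLimit.sum Finset.univ fun k _ => t1 i i k k).const_mul (1 / 2))).sub
    (DominatedLimit.sum Finset.univ fun j _ => t2 j)
  have l := d.tendsto_integral (fun _ => hBint) hBint
    (Eventually.of_forall fun _ => tendsto_const_nhds) tendsto_const_nhds
  have z : ∀ n, ∫ x, ((∑ i, ∑ j, w j i n x * ⟪G i x, G j x⟫)
      - (1 / 2 : ℝ) * (∑ i, ∑ k, w i i n x * ⟪G k x, G k x⟫)
      - ∑ j, w j j n x * F (Q x)) = 0 := fun n => by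
    have := integral_inner_variation hr hF hQ hg hG hQr hgC hw hsol hinner hG2
      (X := fun j x => R n * cutoffCoord j ((R n)⁻¹ • x)) fun j => (hY j).dilate (hR0 n)
    simpa only [fderiv_dilate_apply ((hY _).1.differentiable (by simp)) (hR0 n)] using this
  have l0 := tendsto_nhds_unique (tendsto_const_nhds.congr fun n => (z n).symm) l
  -- The limiting integrand is `(1 - 3/2)|∇Q|² - 3F(Q)`, the negative of the one wanted.
  rw [← neg_eq_zero, ← integral_neg, l0]
  congr 1 with x
  simp only [ite_mul, one_mul, zero_mul, Finset.sum_ite_eq, Finset.mem_univ, if_true,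
    real_inner_self_eq_norm_sq, Finset.sum_const, Finset.card_univ, Fintype.card_fin,
    nsmul_eq_mul]
  push_cast
  ring

/-- A locally integrable function with vanishing weak derivatives is constant. -/
theorem exists_ae_eq_const_of_weakDeriv_eq_zero [CompleteSpace E] {Q : Space → E}
    {G : Fin 3 → Space → E} (hQ : LocallyIntegrable Q)
    (hw : ∀ i, HasWeakDeriv (unitVec i) Q (G i)) (h0 : ∀ i, ∀ᵐ x, G i x = 0) :
    ∃ q, ∀ᵐ x, Q x = q := by
  have hρ := mollifier_isTestFunction
  have hconst : ∀ n x y, smoothConv volume (mollifier n) Q x =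
      smoothConv volume (mollifier n) Q y := by
    intro n
    refine is_const_of_fderiv_eq_zero (𝕜 := ℝ)
      ((contDiff_smoothConv (hρ n).1 (hρ n).2 hQ).differentiable (by simp)) fun x => ?_
    refine ContinuousLinearMap.coe_injective
      ((EuclideanSpace.basisFun (Fin 3) ℝ).toBasis.ext fun i => ?_)
    have h1 := (hw i).fderiv_smoothConv hQ (hρ n) x
    rw [smoothConv_apply, integral_eq_zero_of_ae] at h1
    · simpa using h1
    · filter_upwards [h0 i] with y hy
      simp [hy]
  have hlim := tendsto_smoothConv_mollifier hQ
  obtain ⟨x₀, hx₀⟩ := hlim.exists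
  refine ⟨Q x₀, ?_⟩
  filter_upwards [hlim] with x hx
  exact tendsto_nhds_unique hx (hx₀.congr fun n => hconst n x₀ x)

/-- Weak derivatives inherit linear constraints. -/
theorem HasWeakDeriv.inner_eq_zero [CompleteSpace E] {v : Space} {Q G : Space → E}
    (h : HasWeakDeriv v Q G) (hQ : LocallyIntegrable Q) (hG : LocallyIntegrable G) {c : E}
    (hc : ∀ᵐ x, ⟪c, Q x⟫ = 0) : ∀ᵐ x, ⟪c, G x⟫ = 0 := by
  have hL : LocallyIntegrable fun x => ⟪c, G x⟫ := fun x =>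
    (hG x).imp fun s hs => ⟨hs.1, hs.2.const_inner c⟩
  refine ae_eq_zero_of_integral_contDiff_smul_eq_zero hL fun φ h1 h2 => ?_
  have hφ : IsTestFunction φ := ⟨h1, h2⟩
  have e1 := integral_inner (𝕜 := ℝ) (hφ.integrable_smul hG) c
  have e2 := integral_inner (𝕜 := ℝ) ((hφ.fderiv_apply v).integrable_smul hQ) c
  simp only [inner_smul_right] at e1 e2
  simp only [smul_eq_mul]
  rw [e1, ← neg_eq_zero, ← inner_neg_right, ← h φ hφ, ← e2]
  refine integral_eq_zero_of_ae ?_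
  filter_upwards [hc] with x hx
  simp [hx]

end Pohozaev

/-! ### Symmetric matrices -/

namespace SymMat

/-- Tracelessness becomes orthogonality to a fixed vector, a form that weak derivatives inherit by
`HasWeakDeriv.inner_eq_zero`. -/
theorem tr_eq_inner (A : SymMat) : A.tr = ⟪idMat, A⟫ := by
  rw [Submodule.coe_inner, PiLp.inner_apply, Fintype.sum_prod_type]
  simp [tr, idMat]

theorem inner_tracelessPart (A : SymMat) {B : SymMat} (hB : B.tr = 0) :
    ⟪A.tracelessPart, B⟫ = ⟪A, B⟫ := by
  rw [tr_eq_inner] at hB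
  have h : ⟪((1 / 3 : ℝ) * tr A) • idMat, B⟫ = (1 / 3 : ℝ) * tr A * ⟪idMat, B⟫ :=
    real_inner_smul_left (F := SymMat) idMat B _
  rw [tracelessPart, inner_sub_left, h, hB, mul_zero, sub_zero]

/-- Cauchy-Schwarz for the trace. The constant is not sharp, but only boundedness of the right-hand
side of the equation matters. -/
theorem norm_tracelessPart_le (A : SymMat) :
    ‖A.tracelessPart‖ ≤ (1 + 1 / 3 * ‖idMat‖ ^ 2) * ‖A‖ := by
  have h := abs_real_inner_le_norm idMat A
  calc ‖A.tracelessPart‖ ≤ ‖A‖ + ‖((1 / 3 : ℝ) * tr A) • idMat‖ := norm_sub_le _ _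
    _ = ‖A‖ + 1 / 3 * |⟪idMat, A⟫| * ‖idMat‖ := by
      rw [norm_smul, tr_eq_inner, Real.norm_eq_abs, abs_mul, abs_of_pos (by norm_num : (0:ℝ) < 1/3)]
    _ ≤ ‖A‖ + 1 / 3 * (‖idMat‖ * ‖A‖) * ‖idMat‖ := by gcongr
    _ = _ := by ring

end SymMat

/-! ### The matrix-valued equation: Pohozaev identity and rigidity -/

theorem inner_potentialGrad (F : SymMat → ℝ) (r : ℝ) (q B : SymMat) :
    ⟪potentialGrad F r q, B⟫ = fderivWithin ℝ F (closedBall 0 r) q B :=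
  InnerProductSpace.toDual_symm_apply

theorem norm_potentialGrad (F : SymMat → ℝ) (r : ℝ) (q : SymMat) :
    ‖potentialGrad F r q‖ = ‖fderivWithin ℝ F (closedBall 0 r) q‖ :=
  LinearIsometryEquiv.norm_map _ _

theorem lemma1 (r₂ : ℝ) (hr₂ : 0 < r₂)
    (F : SymMat → ℝ) (hF : ContDiffOn ℝ 2 F (Metric.closedBall 0 r₂)) (hF0 : F 0 = 0)
    (Q : Space → SymMat) (hQtr : ∀ᵐ x, (Q x).tr = 0)
    (hQ : IsStationarySolution F r₂ Q) (hQr : ∀ᵐ x, ‖Q x‖ ≤ r₂)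
    (G : Fin 3 → Space → SymMat) (hG : HasWeakGradient Q G)
    (hG2 : Integrable (gradNormSq G)) (hFQ : Integrable fun x => F (Q x)) :
    (∫ x, ((1 / 2 : ℝ) * gradNormSq G x + 3 * F (Q x)) = 0) ∧
    ((∀ q : SymMat, ‖q‖ ≤ r₂ → 0 ≤ F q) →
      ∃ q : SymMat, ‖q‖ ≤ r₂ ∧ q.tr = 0 ∧ F q = 0 ∧ ∀ᵐ x, Q x = q) ∧
    ((∀ q : SymMat, ‖q‖ ≤ r₂ → q ≠ 0 → 0 < F q) → ∀ᵐ x, Q x = 0) := by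
  obtain ⟨hQloc, hgloc, hsol⟩ := hQ
  have hGloc : ∀ i, LocallyIntegrable (G i) := fun i => (hG.2 i).1
  have hw : ∀ i, HasWeakDeriv (unitVec i) Q (G i) := fun i => (hG.2 i).2
  have hF1 : ContDiffOn ℝ 1 F (closedBall 0 r₂) := hF.of_le one_le_two
  have huniq : UniqueDiffOn ℝ (closedBall (0 : SymMat) r₂) :=
    uniqueDiffOn_convex (convex_closedBall 0 r₂)
      ⟨0, ball_subset_interior_closedBall (mem_ball_self hr₂)⟩
  obtain ⟨C, hC⟩ := (isCompact_closedBall (0 : SymMat) r₂).exists_bound_of_continuousOn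
    (f := fderivWithin ℝ F (closedBall 0 r₂)) (hF1.continuousOn_fderivWithin huniq le_rfl)
  have hgC : ∀ᵐ x, ‖SymMat.tracelessPart (potentialGrad F r₂ (Q x))‖
      ≤ (1 + 1 / 3 * ‖SymMat.idMat‖ ^ 2) * C := by
    filter_upwards [hQr] with x hx
    refine (SymMat.norm_tracelessPart_le _).trans (mul_le_mul_of_nonneg_left ?_ (by positivity))
    rw [norm_potentialGrad]
    exact hC _ (mem_closedBall_zero_iff.2 hx)
  have hGtr : ∀ i, ∀ᵐ x, (G i x).tr = 0 := fun i => by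
    simp only [SymMat.tr_eq_inner] at hQtr ⊢
    exact (hw i).inner_eq_zero hQloc (hGloc i) hQtr
  have hinner : ∀ i, ∀ᵐ x, ⟪SymMat.tracelessPart (potentialGrad F r₂ (Q x)), G i x⟫
      = fderivWithin ℝ F (closedBall 0 r₂) (Q x) (G i x) := fun i => by
    filter_upwards [hGtr i] with x hx
    rw [SymMat.inner_tracelessPart _ hx, inner_potentialGrad]
  have hpoh : ∫ x, ((1 / 2 : ℝ) * gradNormSq G x + 3 * F (Q x)) = 0 :=
    pohozaev_identity hr₂ hF1 hQloc hgloc hGloc hQr hgC hw hsol hinner hG2 hFQ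
  have hrigid : (∀ q : SymMat, ‖q‖ ≤ r₂ → 0 ≤ F q) →
      ∃ q : SymMat, ‖q‖ ≤ r₂ ∧ q.tr = 0 ∧ F q = 0 ∧ ∀ᵐ x, Q x = q := by
    intro hpos
    have hnn : ∀ x, 0 ≤ gradNormSq G x := fun x => Finset.sum_nonneg fun i _ => sq_nonneg _
    have hFnn : ∀ᵐ x, 0 ≤ F (Q x) := by
      filter_upwards [hQr] with x hx using hpos _ hx
    -- A nonnegative integrand with zero integral vanishes almost everywhere, and with it both of
    -- its nonnegative summands.
    have hzero := (integral_eq_zero_iff_of_nonneg_ae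
      (by filter_upwards [hFnn] with x hx
          have := hnn x
          simp only [Pi.zero_apply, Pi.add_apply]
          linarith)
      ((hG2.const_mul (1 / 2)).add (hFQ.const_mul 3))).1 hpoh
    have hG0 : ∀ i, ∀ᵐ x, G i x = 0 := fun i => by
      filter_upwards [hzero, hFnn] with x hx hx'
      simp only [Pi.zero_apply, Pi.add_apply] at hx
      have h1 : gradNormSq G x = 0 := by linarith [hnn x]
      have h2 := (Finset.sum_eq_zero_iff_of_nonneg fun i _ => sq_nonneg _).1 h1 i
        (Finset.mem_univ i)
      simpa using h2
    obtain ⟨q, hq⟩ := exists_ae_eq_const_of_weakDeriv_eq_zero hQloc hw hG0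
    -- The constraints hold almost everywhere, so a single good point transfers all of them to the
    -- constant `q`.
    obtain ⟨x, hx, hxr, hxtr, hx0, hxF⟩ :=
      (hq.and (hQr.and (hQtr.and (hzero.and hFnn)))).exists
    rw [hx] at hxr hxtr hxF
    refine ⟨q, hxr, hxtr, ?_, hq⟩
    simp only [Pi.zero_apply, Pi.add_apply, hx] at hx0
    linarith [hnn x]
  refine ⟨hpoh, hrigid, fun hpos => ?_⟩
  obtain ⟨q, hqr, -, hqF, hq⟩ := hrigid fun q hq => by
    rcases eq_or_ne q 0 with rfl | h
    · exact hF0.ge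
    · exact (hpos q hq h).le
  have hq0 : q = 0 := by
    by_contra h
    exact (hpos q hqr h).ne' hqF
  simpa only [hq0] using hq
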